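/- Let $\mathbb K$ be $\mathbb R$ or $\mathbb C$, let $X$ be a metric space with base point $0$, and let $E$ be a Banach space over $\mathbb K$. For a normed space $G$, $Lip_0(X;G)$ is the set of Lipschitz maps $g:X\to G$ with $g(0)=0$, $Lip(g)=\sup_{x\neq y}\|g(x)-g(y)\|/d(x,y)$, and $B_{X^\#}$ is the set of $f\in Lip_0(X;\mathbb K)$ with $Lip(f)\le 1$. A map $R:X\to E$ is *Lipschitz Grothendieck-integral* ($R\in Lip_{0GI}(X;E)$) if $R\in Lip_0(X;E)$ and there are a finite measure space $(\Omega,\Sigma,\mu)$, a map $g\in Lip_0(X;L_\infty(\mu))$ and a bounded linear operator $A:L_1(\mu)\to E^{**}$ with $\kappa_E\circ R=A\circ I_{\infty,1}\circ g$, where $\kappa_E:E\to E^{**}$ is the canonical embedding and $I_{\infty,1}:L_\infty(\mu)\to L_1(\mu)$ is the inclusion. Then $Lip_{GI}(R)$ is the infimum of $\|A\|\,\mu(\Omega)\,Lip(g)$ over all such factorizations. For Banach spaces $G,F$, let $LipL_0(X\times G;F)$ be the set of maps $T:X\times G\to F$ that are linear in the second variable, vanish on $\{0\}\times G$, and satisfy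 $\|T(x,e)-T(y,e)\|\le C\,d(x,y)\|e\|$ for some $C>0$ and all $x,y\in X$, $e\in G$. Such a $T$ is *integral* if there is $C>0$ such that for all $n$, all $x_1,\dots,x_n,y_1,\dots,y_n\in X$, $e_1,\dots,e_n\in G$ and $z_1^*,\dots,z_n^*\in F^*$, $$\Bigl|\sum_{i=1}^n\langle T(x_i,e_i)-T(y_i,e_i),z_i^*\rangle\Bigr|\le C\sup_{f\in B_{X^\#},\ e^*\in G^*,\ \|e^*\|=1}\Bigl\|\sum_{i=1}^n (f(x_i)-f(y_i))\,e^*(e_i)\,z_i^*\Bigr\|_{F^*}$$ (a supremum over the empty set being $0$), and $\mathfrak I^{LipL}_{int}(T)$ is the infimum of these $C$. **Proposition.** Let $R:X\to E$ be a Lipschitz map and let $T_R:X\times E^*\to\mathbb K$, $T_R(x,e^*)=e^*(R(x))$. The following are equivalent: 1. $R\in Lip_{0GI}(X;E)$. 2. $T_R\in LipL_0(X\times E^*;\mathbb K)$ and $T_R$ is integral. In this case, $Lip_{GI}(R)=\mathfrak I^{LipL}_{int}(T_R)$. -/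

import Mathlib

open MeasureTheory
open scoped ENNReal

universe u v w

noncomputable section

namespace LipLin

/-- The Lipschitz number `Lip(g) = sup_{x ≠ y} ‖g x - g y‖ / d(x, y)` of a map `g` from a metric
space into a normed space (a real number when `g` is Lipschitz). -/
def lipNumber {X G : Type*} [MetricSpace X] [NormedAddCommGroup G] (g : X → G) : ℝ :=
  sSup {r : ℝ | ∃ x y : X, x ≠ y ∧ r = ‖g x - g y‖ / dist x y}

/-- `g ∈ Lip₀(X; G)`: the map `g` is Lipschitz and sends the base point `o` of `X` to `0`. -/
def IsLipZero {X G : Type*} [MetricSpace X] [NormedAddCommGroup G] (o : X) (g : X → G) : Prop :=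
  (∃ K, LipschitzWith K g) ∧ g o = 0

/-- The inclusion `I_{∞,1} : L_∞(μ) → L_1(μ)` for a finite measure `μ`. -/
def linftyToL1 {𝕜 Ω : Type*} [RCLike 𝕜] [MeasurableSpace Ω] (μ : Measure Ω) [IsFiniteMeasure μ]
    (h : Lp 𝕜 ∞ μ) : Lp 𝕜 1 μ :=
  ((Lp.memLp h).mono_exponent le_top).toLp (h : Ω → 𝕜)

/-- `κ_E ∘ R = A ∘ I_{∞,1} ∘ g` with `g ∈ Lip₀(X; L_∞(μ))` and `A : L_1(μ) → E**` bounded and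
linear, where `κ_E : E → E**` is the canonical embedding. -/
def IsGIFactorization {𝕜 : Type w} {X : Type u} {E : Type v} [RCLike 𝕜] [MetricSpace X]
    [NormedAddCommGroup E] [NormedSpace 𝕜 E] (o : X) (R : X → E)
    {Ω : Type (max u v w)} [MeasurableSpace Ω] (μ : Measure Ω) [IsFiniteMeasure μ]
    (g : X → Lp 𝕜 ∞ μ) (A : Lp 𝕜 1 μ →L[𝕜] StrongDual 𝕜 (StrongDual 𝕜 E)) : Prop :=
  IsLipZero o g ∧
    ∀ x, NormedSpace.inclusionInDoubleDual 𝕜 E (R x) = A (linftyToL1 μ (g x))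

/-- `R ∈ Lip_{0GI}(X; E)`: the map `R` is Lipschitz Grothendieck-integral. -/
def IsLipGI (𝕜 : Type w) {X : Type u} {E : Type v} [RCLike 𝕜] [MetricSpace X]
    [NormedAddCommGroup E] [NormedSpace 𝕜 E] (o : X) (R : X → E) : Prop :=
  IsLipZero o R ∧
    ∃ (Ω : Type (max u v w)) (_ : MeasurableSpace Ω) (μ : Measure Ω) (_ : IsFiniteMeasure μ)
      (g : X → Lp 𝕜 ∞ μ) (A : Lp 𝕜 1 μ →L[𝕜] StrongDual 𝕜 (StrongDual 𝕜 E)),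
      IsGIFactorization o R μ g A

set_option maxSynthPendingDepth 4 in
/-- `Lip_{GI}(R)`: the infimum of `‖A‖ μ(Ω) Lip(g)` over all factorizations
`κ_E ∘ R = A ∘ I_{∞,1} ∘ g`. -/
def lipGINorm (𝕜 : Type w) {X : Type u} {E : Type v} [RCLike 𝕜] [MetricSpace X]
    [NormedAddCommGroup E] [NormedSpace 𝕜 E] (o : X) (R : X → E) : ℝ :=
  sInf {c : ℝ | ∃ (Ω : Type (max u v w)) (_ : MeasurableSpace Ω) (μ : Measure Ω)
      (_ : IsFiniteMeasure μ) (g : X → Lp 𝕜 ∞ μ)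
      (A : Lp 𝕜 1 μ →L[𝕜] StrongDual 𝕜 (StrongDual 𝕜 E)),
      IsGIFactorization o R μ g A ∧ c = ‖A‖ * μ.real Set.univ * lipNumber g}

/-- `T ∈ LipL₀(X × E; F)`: `T` is Lip-Linear and `T(o, e) = 0` for all `e`. -/
def IsLipLinearZero (𝕜 : Type*) {X E F : Type*} [RCLike 𝕜] [MetricSpace X]
    [NormedAddCommGroup E] [NormedSpace 𝕜 E] [NormedAddCommGroup F] [NormedSpace 𝕜 F]
    (o : X) (T : X × E → F) : Prop :=
  (∃ C : ℝ, 0 < C ∧ ∀ x y e, ‖T (x, e) - T (y, e)‖ ≤ C * dist x y * ‖e‖) ∧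
    (∀ x, IsLinearMap 𝕜 fun e => T (x, e)) ∧ ∀ e, T (o, e) = 0

/-- The supremum of `‖∑ i, (f (xᵢ) - f (yᵢ)) e*(eᵢ) zᵢ*‖` over all `f` in the closed unit ball of
`X^# = Lip₀(X; 𝕜)` and all `e* ∈ E*` with `‖e*‖ = 1`. -/
def weakSup {𝕜 X E F : Type*} [RCLike 𝕜] [MetricSpace X]
    [NormedAddCommGroup E] [NormedSpace 𝕜 E] [NormedAddCommGroup F] [NormedSpace 𝕜 F]
    (o : X) {n : ℕ} (x y : Fin n → X) (e : Fin n → E) (z : Fin n → StrongDual 𝕜 F) : ℝ :=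
  sSup {r : ℝ | ∃ (f : X → 𝕜) (φ : StrongDual 𝕜 E), f o = 0 ∧ LipschitzWith 1 f ∧ ‖φ‖ = 1 ∧
    r = ‖∑ i, ((f (x i) - f (y i)) * φ (e i)) • z i‖}

/-- The constant `C` satisfies the inequality that defines integrality of `T`. -/
def IsIntegralBound (𝕜 : Type*) {X E F : Type*} [RCLike 𝕜] [MetricSpace X]
    [NormedAddCommGroup E] [NormedSpace 𝕜 E] [NormedAddCommGroup F] [NormedSpace 𝕜 F]
    (o : X) (T : X × E → F) (C : ℝ) : Prop :=
  ∀ (n : ℕ) (x y : Fin n → X) (e : Fin n → E) (z : Fin n → StrongDual 𝕜 F),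
    ‖∑ i, z i (T (x i, e i) - T (y i, e i))‖ ≤ C * weakSup o x y e z

/-- `T ∈ LipL₀^int(X × E; F)`: the Lip-Linear operator `T` is integral. -/
def IsIntegral (𝕜 : Type*) {X E F : Type*} [RCLike 𝕜] [MetricSpace X]
    [NormedAddCommGroup E] [NormedSpace 𝕜 E] [NormedAddCommGroup F] [NormedSpace 𝕜 F]
    (o : X) (T : X × E → F) : Prop :=
  IsLipLinearZero 𝕜 o T ∧ ∃ C : ℝ, 0 < C ∧ IsIntegralBound 𝕜 o T C

/-- The integral norm `𝔍_int^LipL(T)`: the infimum of the constants in the definition. -/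
def integralNorm (𝕜 : Type*) {X E F : Type*} [RCLike 𝕜] [MetricSpace X]
    [NormedAddCommGroup E] [NormedSpace 𝕜 E] [NormedAddCommGroup F] [NormedSpace 𝕜 F]
    (o : X) (T : X × E → F) : ℝ :=
  sInf {C : ℝ | 0 < C ∧ IsIntegralBound 𝕜 o T C}

/-- The form `T_R : X × E* → 𝕜`, `T_R (x, e*) = e* (R x)`. -/
def lipLinearForm (𝕜 : Type*) {X E : Type*} [RCLike 𝕜] [NormedAddCommGroup E] [NormedSpace 𝕜 E]
    (R : X → E) : X × StrongDual 𝕜 E → 𝕜 :=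
  fun p => p.2 (R p.1)

end LipLin

end

/-
If `κ_E ∘ R = A ∘ I_{∞,1} ∘ g`, the averages of `g` over measurable sets are, up to the factor
`Lip(g)`, elements of `B_{X^#}`; since almost every value of an integrable function lies in every
closed set that contains all its averages, `∑ (g(xᵢ) - g(yᵢ)) eᵢ` is bounded a.e. by the supremum
in the definition of integrality, and `‖A‖ μ(Ω) Lip(g)` is an integral bound for `T_R`.
Conversely, an integral bound `C` makes `T_R` a functional of norm at most `C` on the span of the
products `(f, e**) ↦ f(x) e**(e*)` in `C(B_{X^#} × B_{E**})`. A Hahn-Banach extension of it is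
dominated by a measure of mass at most `C`, hence extends to `L_1` of that measure, and
`g(x) = ((f, e**) ↦ f(x))` gives the factorization.
-/

namespace LipLin

section Measure

variable {𝕜 Ω V H G : Type*} [RCLike 𝕜] [MeasurableSpace Ω] {μ : Measure Ω}
  [NormedAddCommGroup V] [NormedAddCommGroup H] [NormedAddCommGroup G]

lemma ae_norm_le_norm_Lp_top (h : Lp G ∞ μ) : ∀ᵐ ω ∂μ, ‖h ω‖ ≤ ‖h‖ := by
  filter_upwards [enorm_ae_le_eLpNormEssSup h μ] with ω hω
  rw [Lp.norm_def, ← toReal_enorm]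
  exact ENNReal.toReal_mono (Lp.eLpNorm_ne_top h) (by rwa [eLpNorm_exponent_top])

lemma norm_setAverage_sub_setAverage_le [IsFiniteMeasure μ] [NormedSpace ℝ G] (h h' : Lp G ∞ μ)
    (s : Set Ω) : ‖(⨍ ω in s, h ω ∂μ) - ⨍ ω in s, h' ω ∂μ‖ ≤ ‖h - h'‖ := by
  have integrable (k : Lp G ∞ μ) : IntegrableOn k s μ :=
    ((Lp.memLp k).integrable le_top).integrableOn
  have ae_le : ∀ᵐ ω ∂μ.restrict s, ‖h ω - h' ω‖ ≤ ‖h - h'‖ := ae_restrict_of_ae <| by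
    filter_upwards [ae_norm_le_norm_Lp_top (h - h'), Lp.coeFn_sub h h'] with ω hω hsub
    rwa [hsub] at hω
  rw [setAverage_eq, setAverage_eq, ← smul_sub, ← integral_sub (integrable h) (integrable h'),
    norm_smul, norm_inv, Real.norm_of_nonneg measureReal_nonneg]
  refine inv_mul_le_of_le_mul₀ measureReal_nonneg (norm_nonneg _) ?_
  rw [mul_comm]
  exact norm_setIntegral_le_of_norm_le_const_ae (measure_lt_top μ s) ae_le

lemma ae_mem_of_forall_setAverage_mem [IsFiniteMeasure μ] [NormedSpace ℝ V] [CompleteSpace V]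
    [SecondCountableTopology V] {f : Ω → V} (hf : Integrable f μ) {t : Set V} (ht : IsClosed t)
    (h : ∀ s, MeasurableSet s → μ s ≠ 0 → ⨍ ω in s, f ω ∂μ ∈ t) : ∀ᵐ ω ∂μ, f ω ∈ t := by
  borelize V
  wlog hfm : Measurable f generalizing f
  · have hae := hf.1.ae_eq_mk
    filter_upwards [hae, this (hf.congr hae) (fun s hs hs0 => by
      rw [← setAverage_congr_fun hs (hae.mono fun ω hω _ => hω)]
      exact h s hs hs0) hf.1.stronglyMeasurable_mk.measurable] with ω hω hmem
    rwa [hω]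
  have exists_ball (v : V) (hv : v ∈ tᶜ) : ∃ r > 0, Metric.closedBall v r ⊆ tᶜ :=
    Metric.nhds_basis_closedBall.mem_iff.1 (ht.isOpen_compl.mem_nhds hv)
  choose! r hr hrt using exists_ball
  obtain ⟨c, hct, hc, hcover⟩ := TopologicalSpace.countable_cover_nhdsWithin fun v hv =>
    mem_nhdsWithin_of_mem_nhds (Metric.closedBall_mem_nhds v (hr v hv))
  have null_ball (v : V) (hv : v ∈ c) : μ (f ⁻¹' Metric.closedBall v (r v)) = 0 := by
    by_contra hne
    have hs := hfm (Metric.isClosed_closedBall (x := v) (ε := r v)).measurableSet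
    exact hrt v (hct hv) ((convex_closedBall v (r v)).set_average_mem Metric.isClosed_closedBall
      hne (measure_ne_top μ _) (ae_restrict_of_forall_mem hs fun _ hω => hω) hf.integrableOn)
      (h _ hs hne)
  refine measure_mono_null (fun ω hω => ?_) ((measure_biUnion_null_iff hc).2 null_ball)
  simpa using hcover hω

variable [NormedSpace 𝕜 V] [NormedSpace 𝕜 H] [NormedSpace 𝕜 G]

lemma norm_apply_le_mul_integral_norm (Φ : Lp V 1 μ →L[𝕜] G) (q : V →L[𝕜] H) {C : ℝ}
    (hΦ : ∀ (v : V) {s : Set Ω} (hs : MeasurableSet s) (hμs : μ s ≠ ∞),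
      ‖Φ (indicatorConstLp 1 hs hμs v)‖ ≤ C * (μ.real s * ‖q v‖))
    (F : Lp V 1 μ) : ‖Φ F‖ ≤ C * ∫ ω, ‖q (F ω)‖ ∂μ := by
  induction F using Lp.induction ENNReal.one_ne_top with
  | @indicatorConst v s hs hμs =>
    rw [Lp.simpleFunc.coe_indicatorConst]
    refine (hΦ v hs hμs.ne).trans_eq ?_
    rw [← smul_eq_mul (μ.real _), ← integral_indicator_const _ hs]
    congr 1
    refine integral_congr_ae ?_
    filter_upwards [indicatorConstLp_coeFn (p := 1) (hs := hs) (hμs := hμs.ne) (c := v)] with ω hω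
    rw [hω]
    by_cases hmem : ω ∈ s <;> simp [hmem]
  | @add f g hf hg hdisj ihf ihg =>
    have integral_split : ∫ ω, ‖q ((hf.toLp f + hg.toLp g : Lp V 1 μ) ω)‖ ∂μ =
        (∫ ω, ‖q (hf.toLp f ω)‖ ∂μ) + ∫ ω, ‖q (hg.toLp g ω)‖ ∂μ := by
      rw [← integral_add (q.integrable_comp (L1.integrable_coeFn _)).norm
        (q.integrable_comp (L1.integrable_coeFn _)).norm]
      refine integral_congr_ae ?_
      filter_upwards [Lp.coeFn_add (hf.toLp f) (hg.toLp g), hf.coeFn_toLp, hg.coeFn_toLp]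
        with ω hadd hfω hgω
      have eq_zero_or : f ω = 0 ∨ g ω = 0 := by
        by_contra! hne
        exact Set.disjoint_left.1 hdisj hne.1 hne.2
      rw [hadd, Pi.add_apply, hfω, hgω]
      rcases eq_zero_or with h0 | h0 <;> simp [h0]
    rw [map_add, integral_split, mul_add]
    exact norm_add_le_of_le ihf ihg
  | isClosed =>
    have integral_eq_norm (F : Lp V 1 μ) : ∫ ω, ‖q (F ω)‖ ∂μ = ‖q.compLpL 1 μ F‖ := by
      rw [L1.norm_eq_integral_norm]
      exact integral_congr_ae ((q.coeFn_compLpL F).fun_comp norm).symm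
    simp only [integral_eq_norm]
    exact isClosed_le (by fun_prop) (by fun_prop)

lemma compLpL_indicatorConstLp {p : ℝ≥0∞} [Fact (1 ≤ p)] (q : V →L[𝕜] 𝕜) {s : Set Ω}
    (hs : MeasurableSet s) (hμs : μ s ≠ ∞) (v : V) :
    q.compLpL p μ (indicatorConstLp p hs hμs v) = q v • indicatorConstLp p hs hμs 1 := by
  refine Lp.ext ?_
  filter_upwards [q.coeFn_compLpL (indicatorConstLp p hs hμs v),
    Lp.coeFn_smul (q v) (indicatorConstLp (μ := μ) p hs hμs (1 : 𝕜)),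
    indicatorConstLp_coeFn (p := p) (hs := hs) (hμs := hμs) (c := v),
    indicatorConstLp_coeFn (p := p) (hs := hs) (hμs := hμs) (c := (1 : 𝕜))]
    with ω hcomp hsmul hv hone
  rw [hcomp, hsmul, Pi.smul_apply, hv, hone]
  by_cases hω : ω ∈ s <;> simp [hω]

lemma norm_sum_apply_le_mul_integral_norm {ι : Type*} [Fintype ι]
    (A : Lp 𝕜 1 μ →L[𝕜] H →L[𝕜] G) (F : ι → Lp 𝕜 1 μ) (e : ι → H) :
    ‖∑ i, A (F i) (e i)‖ ≤ ‖A‖ * ∫ ω, ‖∑ i, F i ω • e i‖ ∂μ := by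
  let coord (i : ι) : (ι → 𝕜) →L[𝕜] 𝕜 := ContinuousLinearMap.proj i
  let combine : (ι → 𝕜) →L[𝕜] H := ∑ i, (coord i).smulRight (e i)
  let Φ : Lp (ι → 𝕜) 1 μ →L[𝕜] G := ∑ i, A.flip (e i) ∘L (coord i).compLpL 1 μ
  have combine_apply (v : ι → 𝕜) : combine v = ∑ i, v i • e i := by simp [combine, coord]
  have hF : MemLp (fun ω i => F i ω) 1 μ :=
    memLp_one_iff_integrable.2 (Integrable.of_eval fun i => L1.integrable_coeFn (F i))
  have compLpL_coord (i : ι) : (coord i).compLpL 1 μ (hF.toLp _) = F i := by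
    refine Lp.ext ?_
    filter_upwards [(coord i).coeFn_compLpL (hF.toLp _), hF.coeFn_toLp] with ω h1 h2
    rw [h1, h2]
    rfl
  have Φ_indicator (v : ι → 𝕜) {s : Set Ω} (hs : MeasurableSet s) (hμs : μ s ≠ ∞) :
      ‖Φ (indicatorConstLp 1 hs hμs v)‖ ≤ ‖A‖ * (μ.real s * ‖combine v‖) := by
    calc ‖Φ (indicatorConstLp 1 hs hμs v)‖
        = ‖A (indicatorConstLp 1 hs hμs 1) (combine v)‖ := by
          simp [Φ, compLpL_indicatorConstLp, combine_apply, coord]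
      _ ≤ ‖A‖ * ‖indicatorConstLp 1 hs hμs (1 : 𝕜)‖ * ‖combine v‖ := A.le_opNorm₂ _ _
      _ = ‖A‖ * (μ.real s * ‖combine v‖) := by
          rw [norm_indicatorConstLp one_ne_zero ENNReal.one_ne_top]
          simp [mul_assoc]
  calc ‖∑ i, A (F i) (e i)‖ = ‖Φ (hF.toLp _)‖ := by simp [Φ, compLpL_coord]
    _ ≤ ‖A‖ * ∫ ω, ‖combine (hF.toLp _ ω)‖ ∂μ :=
        norm_apply_le_mul_integral_norm Φ combine Φ_indicator _
    _ = ‖A‖ * ∫ ω, ‖∑ i, F i ω • e i‖ ∂μ := by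
        congr 1
        refine integral_congr_ae ?_
        filter_upwards [hF.coeFn_toLp] with ω hω
        rw [hω, combine_apply]

lemma norm_sum_apply_le_of_setAverage [IsFiniteMeasure μ] {ι : Type*} [Fintype ι]
    (A : Lp 𝕜 1 μ →L[𝕜] H →L[𝕜] G) (F : ι → Lp 𝕜 1 μ) (e : ι → H) {B : ℝ}
    (hB : ∀ s, MeasurableSet s → μ s ≠ 0 → ‖∑ i, (⨍ ω in s, F i ω ∂μ) • e i‖ ≤ B) :
    ‖∑ i, A (F i) (e i)‖ ≤ ‖A‖ * μ.real Set.univ * B := by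
  have hF : Integrable (fun ω i => F i ω) μ := .of_eval fun i => L1.integrable_coeFn (F i)
  have isClosed_ball : IsClosed {v : ι → 𝕜 | ‖∑ i, v i • e i‖ ≤ B} :=
    isClosed_le (by fun_prop) continuous_const
  have ae_le : ∀ᵐ ω ∂μ, ‖∑ i, F i ω • e i‖ ≤ B :=
    ae_mem_of_forall_setAverage_mem hF isClosed_ball fun s hs hs0 => by
      have average_apply (i : ι) : (⨍ ω in s, (fun i => F i ω) ∂μ) i = ⨍ ω in s, F i ω ∂μ := by
        rw [setAverage_eq, setAverage_eq, Pi.smul_apply,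
          eval_integral fun i => hF.integrableOn.eval i]
      simpa [average_apply] using hB s hs hs0
  calc ‖∑ i, A (F i) (e i)‖ ≤ ‖A‖ * ∫ ω, ‖∑ i, F i ω • e i‖ ∂μ :=
        norm_sum_apply_le_mul_integral_norm A F e
    _ ≤ ‖A‖ * (μ.real Set.univ * B) := by
        gcongr
        refine (integral_mono_of_nonneg (ae_of_all _ fun ω => norm_nonneg _)
          (integrable_const B) ae_le).trans_eq ?_
        rw [integral_const, smul_eq_mul]
    _ = ‖A‖ * μ.real Set.univ * B := (mul_assoc ..).symm

end Measure

section LipNumber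

variable {X G : Type*} [MetricSpace X] [NormedAddCommGroup G] {g : X → G}

lemma lipNumber_nonneg (g : X → G) : 0 ≤ lipNumber g := by
  apply Real.sSup_nonneg
  rintro r ⟨x, y, -, rfl⟩
  positivity

lemma lipNumber_le {K : ℝ} (hK : 0 ≤ K) (h : ∀ x y, ‖g x - g y‖ ≤ K * dist x y) :
    lipNumber g ≤ K := by
  refine Real.sSup_le ?_ hK
  rintro r ⟨x, y, hxy, rfl⟩
  exact (div_le_iff₀ (dist_pos.2 hxy)).2 (h x y)

lemma norm_sub_le_lipNumber_mul (hg : ∃ K, LipschitzWith K g) (x y : X) :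
    ‖g x - g y‖ ≤ lipNumber g * dist x y := by
  rcases eq_or_ne x y with rfl | hxy
  · simp
  obtain ⟨K, hK⟩ := hg
  rw [← div_le_iff₀ (dist_pos.2 hxy)]
  refine le_csSup ⟨K, ?_⟩ ⟨x, y, hxy, rfl⟩
  rintro r ⟨x, y, hxy, rfl⟩
  rw [div_le_iff₀ (dist_pos.2 hxy), ← dist_eq_norm]
  exact hK.dist_le_mul x y

end LipNumber

section WeakSup

variable {𝕜 X E F : Type*} [RCLike 𝕜] [MetricSpace X] [NormedAddCommGroup E] [NormedSpace 𝕜 E]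
  [NormedAddCommGroup F] [NormedSpace 𝕜 F] {o : X} {n : ℕ}

lemma weakSup_nonneg (o : X) (x y : Fin n → X) (e : Fin n → E) (z : Fin n → StrongDual 𝕜 F) :
    0 ≤ weakSup o x y e z := by
  apply Real.sSup_nonneg
  rintro r ⟨f, φ, -, -, -, rfl⟩
  positivity

lemma le_weakSup {f : X → 𝕜} {φ : StrongDual 𝕜 E} (hf0 : f o = 0) (hf : LipschitzWith 1 f)
    (hφ : ‖φ‖ = 1) (x y : Fin n → X) (e : Fin n → E) (z : Fin n → StrongDual 𝕜 F) :
    ‖∑ i, ((f (x i) - f (y i)) * φ (e i)) • z i‖ ≤ weakSup o x y e z := by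
  refine le_csSup ⟨∑ i, dist (x i) (y i) * ‖e i‖ * ‖z i‖, ?_⟩ ⟨f, φ, hf0, hf, hφ, rfl⟩
  rintro r ⟨f, φ, -, hf, hφ, rfl⟩
  refine norm_sum_le_of_le _ fun i _ => ?_
  have norm_f_sub_le : ‖f (x i) - f (y i)‖ ≤ dist (x i) (y i) := by
    simpa [dist_eq_norm] using hf.dist_le_mul (x i) (y i)
  have norm_φ_le : ‖φ (e i)‖ ≤ ‖e i‖ := by simpa [hφ] using φ.le_opNorm (e i)
  rw [norm_smul, norm_mul]
  gcongr

lemma norm_sum_smul_le_mul_weakSup {f : X → 𝕜} {L : ℝ} (hL : 0 ≤ L) (hf0 : f o = 0)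
    (hf : ∀ a b, ‖f a - f b‖ ≤ L * dist a b) (x y : Fin n → X) (e : Fin n → E)
    (z : Fin n → StrongDual 𝕜 𝕜) :
    ‖∑ i, (f (x i) - f (y i)) • z i 1 • e i‖ ≤ L * weakSup o x y e z := by
  set v := ∑ i, (f (x i) - f (y i)) • z i 1 • e i with hv
  rcases eq_or_ne v 0 with hv0 | hv0
  · simpa [hv0] using mul_nonneg hL (weakSup_nonneg o x y e z)
  rcases hL.eq_or_lt with rfl | hL
  · have f_sub_eq_zero (a b : X) : f a - f b = 0 := by simpa using hf a b
    simp [hv, f_sub_eq_zero] at hv0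
  obtain ⟨φ, hφ, hφv⟩ := exists_dual_vector 𝕜 v (norm_ne_zero_iff.2 hv0)
  have lipschitz : LipschitzWith 1 fun a => (L : 𝕜)⁻¹ * f a := by
    refine LipschitzWith.of_dist_le_mul fun a b => ?_
    rw [dist_eq_norm, ← mul_sub, norm_mul, norm_inv, RCLike.norm_ofReal, abs_of_pos hL,
      NNReal.coe_one, one_mul, inv_mul_le_iff₀ hL]
    exact hf a b
  have hL' : (L : 𝕜) ≠ 0 := by exact_mod_cast hL.ne'
  set ζ := ∑ i, (((L : 𝕜)⁻¹ * f (x i) - (L : 𝕜)⁻¹ * f (y i)) * φ (e i)) • z i with hζ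
  have φ_eq : φ v = L * ζ 1 := by
    simp only [hv, hζ, map_sum, map_smul, sum_apply, smul_apply, smul_eq_mul, Finset.mul_sum]
    exact Finset.sum_congr rfl fun i _ => by field_simp
  calc ‖v‖ = ‖φ v‖ := by rw [hφv, RCLike.norm_ofReal, abs_norm]
    _ = L * ‖ζ 1‖ := by rw [φ_eq, norm_mul, RCLike.norm_ofReal, abs_of_pos hL]
    _ ≤ L * ‖ζ‖ := by
        gcongr
        simpa using ζ.le_opNorm 1
    _ ≤ L * weakSup o x y e z := by
        gcongr
        exact le_weakSup (by simp [hf0]) lipschitz hφ x y e z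

lemma IsIntegralBound.mono {T : X × E → F} {C D : ℝ} (h : IsIntegralBound 𝕜 o T C)
    (hCD : C ≤ D) : IsIntegralBound 𝕜 o T D := fun n x y e z =>
  (h n x y e z).trans (mul_le_mul_of_nonneg_right hCD (weakSup_nonneg o x y e z))

end WeakSup

section LinftyToL1

variable {𝕜 Ω : Type*} [RCLike 𝕜] [MeasurableSpace Ω] {μ : Measure Ω} [IsFiniteMeasure μ]

lemma coeFn_linftyToL1 (h : Lp 𝕜 ∞ μ) : linftyToL1 μ h =ᵐ[μ] h :=
  MemLp.coeFn_toLp _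

lemma setAverage_linftyToL1_sub (h h' : Lp 𝕜 ∞ μ) (s : Set Ω) :
    ⨍ ω in s, (linftyToL1 μ h - linftyToL1 μ h') ω ∂μ =
      (⨍ ω in s, h ω ∂μ) - ⨍ ω in s, h' ω ∂μ := by
  have integrable (k : Lp 𝕜 ∞ μ) : IntegrableOn k s μ :=
    ((Lp.memLp k).integrable le_top).integrableOn
  simp only [setAverage_eq]
  rw [← smul_sub, ← integral_sub (integrable h) (integrable h')]
  congr 1
  refine integral_congr_ae (ae_restrict_of_ae ?_)
  filter_upwards [Lp.coeFn_sub (linftyToL1 μ h) (linftyToL1 μ h'), coeFn_linftyToL1 h,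
    coeFn_linftyToL1 h'] with ω hsub hh hh'
  rw [hsub, Pi.sub_apply, hh, hh']

end LinftyToL1

section Bound

variable {𝕜 : Type w} {X : Type u} {E : Type v} [RCLike 𝕜] [MetricSpace X]
  [NormedAddCommGroup E] [NormedSpace 𝕜 E] {o : X} {R : X → E}
  {Ω : Type (max u v w)} [MeasurableSpace Ω] {μ : Measure Ω} [IsFiniteMeasure μ]
  {g : X → Lp 𝕜 ∞ μ} {A : Lp 𝕜 1 μ →L[𝕜] StrongDual 𝕜 (StrongDual 𝕜 E)}

set_option maxSynthPendingDepth 4 in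
lemma IsGIFactorization.isIntegralBound (h : IsGIFactorization o R μ g A) :
    IsIntegralBound 𝕜 o (lipLinearForm 𝕜 R) (‖A‖ * μ.real Set.univ * lipNumber g) := by
  intro n x y e z
  let F (i : Fin n) : Lp 𝕜 1 μ := linftyToL1 μ (g (x i)) - linftyToL1 μ (g (y i))
  have apply_eq (i : Fin n) :
      z i (lipLinearForm 𝕜 R (x i, e i) - lipLinearForm 𝕜 R (y i, e i)) =
        A (F i) (z i 1 • e i) := by
    have z_apply (t : 𝕜) : z i t = z i 1 * t := by
      rw [mul_comm, ← smul_eq_mul, ← map_smul, smul_eq_mul, mul_one]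
    rw [z_apply, map_sub, ← h.2, ← h.2, map_smul, smul_eq_mul]
    simp [lipLinearForm]
  have average_bound (s : Set Ω) :
      ‖∑ i, (⨍ ω in s, F i ω ∂μ) • z i 1 • e i‖ ≤ lipNumber g * weakSup o x y e z := by
    let f (a : X) : 𝕜 := ⨍ ω in s, g a ω ∂μ
    have f_base : f o = 0 := by
      have : f o = ⨍ ω in s, (0 : Ω → 𝕜) ω ∂μ := by
        simp only [f, h.1.2]
        exact average_congr (ae_restrict_of_ae (Lp.coeFn_zero 𝕜 ∞ μ))
      simp [this]
    have f_lip (a b : X) : ‖f a - f b‖ ≤ lipNumber g * dist a b :=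
      (norm_setAverage_sub_setAverage_le _ _ s).trans (norm_sub_le_lipNumber_mul h.1.1 a b)
    simp only [F, setAverage_linftyToL1_sub]
    exact norm_sum_smul_le_mul_weakSup (lipNumber_nonneg g) f_base f_lip x y e z
  simp only [apply_eq]
  rw [mul_assoc _ (lipNumber g)]
  exact norm_sum_apply_le_of_setAverage A F _ fun s _ _ => average_bound s

end Bound

section Duality

lemma exists_strongDual_comp_eq {𝕜 V N : Type*} [RCLike 𝕜] [AddCommGroup V] [Module 𝕜 V]
    [NormedAddCommGroup N] [NormedSpace 𝕜 N] (S : V →ₗ[𝕜] N) (Λ : V →ₗ[𝕜] 𝕜) {C : ℝ} (hC : 0 ≤ C)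
    (h : ∀ v, ‖Λ v‖ ≤ C * ‖S v‖) : ∃ ψ : StrongDual 𝕜 N, ‖ψ‖ ≤ C ∧ ∀ v, ψ (S v) = Λ v := by
  have Λ_mem : Λ ∈ LinearMap.range S.dualMap := by
    rw [LinearMap.range_dualMap_eq_dualAnnihilator_ker, Submodule.mem_dualAnnihilator]
    intro v hv
    simpa [LinearMap.mem_ker.1 hv] using h v
  obtain ⟨χ, rfl⟩ := Λ_mem
  have χ_bound (w : LinearMap.range S) : ‖(χ.domRestrict (LinearMap.range S)) w‖ ≤ C * ‖w‖ := by
    obtain ⟨_, v, rfl⟩ := w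
    exact h v
  obtain ⟨ψ, hψ, hnorm⟩ := exists_extension_norm_eq (LinearMap.range S)
    ((χ.domRestrict (LinearMap.range S)).mkContinuous C χ_bound)
  exact ⟨ψ, hnorm.trans_le (LinearMap.mkContinuous_norm_le _ hC _),
    fun v => hψ ⟨S v, v, rfl⟩⟩

end Duality

section Domination

variable {𝕜 K : Type*} [RCLike 𝕜] [TopologicalSpace K]

/-- The function `(f + |u|)⁺` of a pair `(f, u)`. Its sup norm is sublinear in the pair and vanishes
exactly when `|u| ≤ -f`, so a linear functional that it dominates is monotone in this sense. -/
def addNormPosPart (a : C(K, ℝ) × C(K, 𝕜)) : C(K, ℝ) where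
  toFun k := max (a.1 k + ‖a.2 k‖) 0

lemma addNormPosPart_smul {c : ℝ} (hc : 0 ≤ c) (a : C(K, ℝ) × C(K, 𝕜)) :
    addNormPosPart (c • a) = c • addNormPosPart a := by
  ext k
  simp [addNormPosPart, norm_smul, abs_of_nonneg hc, mul_max_of_nonneg, hc, mul_add]

lemma addNormPosPart_eq_zero {a : C(K, ℝ) × C(K, 𝕜)} (h : ∀ k, ‖a.2 k‖ ≤ -a.1 k) :
    addNormPosPart a = 0 := by
  ext k
  exact max_eq_right (by linarith [h k])

variable [CompactSpace K]

lemma norm_addNormPosPart_le {a : C(K, ℝ) × C(K, 𝕜)} {r : ℝ} (hr : 0 ≤ r)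
    (h : ∀ k, a.1 k + ‖a.2 k‖ ≤ r) : ‖addNormPosPart a‖ ≤ r :=
  (ContinuousMap.norm_le _ hr).2 fun k =>
    (Real.norm_of_nonneg (le_max_right _ _)).trans_le (max_le (h k) hr)

lemma le_norm_addNormPosPart (a : C(K, ℝ) × C(K, 𝕜)) (k : K) :
    a.1 k + ‖a.2 k‖ ≤ ‖addNormPosPart a‖ :=
  (le_max_left _ 0).trans ((le_abs_self _).trans ((addNormPosPart a).norm_coe_le_norm k))

lemma norm_addNormPosPart_add_le (a b : C(K, ℝ) × C(K, 𝕜)) :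
    ‖addNormPosPart (a + b)‖ ≤ ‖addNormPosPart a‖ + ‖addNormPosPart b‖ :=
  norm_addNormPosPart_le (by positivity) fun k => by
    have norm_add : ‖(a + b).2 k‖ ≤ ‖a.2 k‖ + ‖b.2 k‖ := norm_add_le _ _
    have fst_add : (a + b).1 k = a.1 k + b.1 k := rfl
    linarith [le_norm_addNormPosPart a k, le_norm_addNormPosPart b k]

lemma exists_linearMap_norm_apply_le (ψ : StrongDual 𝕜 C(K, 𝕜)) :
    ∃ M : C(K, ℝ) →ₗ[ℝ] ℝ, (∀ f, M f ≤ ‖ψ‖ * ‖f‖) ∧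
      ∀ (h : C(K, ℝ)) (u : C(K, 𝕜)), (∀ k, ‖u k‖ ≤ h k) → ‖ψ u‖ ≤ M h := by
  let p (a : C(K, ℝ) × C(K, 𝕜)) : ℝ := ‖ψ‖ * ‖addNormPosPart a‖
  let reψ : (C(K, ℝ) × C(K, 𝕜)) →ₗ[ℝ] ℝ :=
    RCLike.reLm ∘ₗ ψ.toLinearMap.restrictScalars ℝ ∘ₗ LinearMap.snd ℝ _ _
  have p_smul (c : ℝ) (hc : 0 < c) (a) : p (c • a) = c * p a := by
    simp only [p, addNormPosPart_smul hc.le, norm_smul, Real.norm_of_nonneg hc.le]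
    ring
  have p_add (a b) : p (a + b) ≤ p a + p b := by
    rw [← mul_add]
    exact mul_le_mul_of_nonneg_left (norm_addNormPosPart_add_le a b) (norm_nonneg ψ)
  have reψ_le_p (a : LinearMap.range (LinearMap.inr ℝ C(K, ℝ) C(K, 𝕜))) : reψ a ≤ p a := by
    obtain ⟨_, u, rfl⟩ := a
    refine (RCLike.re_le_norm _).trans ((ψ.le_opNorm u).trans ?_)
    refine mul_le_mul_of_nonneg_left ?_ (norm_nonneg ψ)
    exact (ContinuousMap.norm_le _ (norm_nonneg _)).2 fun k => by
      simpa using le_norm_addNormPosPart (0, u) k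
  obtain ⟨Φ, hΦ, hΦp⟩ := exists_extension_of_le_sublinear
    ⟨LinearMap.range (LinearMap.inr ℝ _ _), reψ.domRestrict _⟩ p p_smul p_add reψ_le_p
  have re_le (h : C(K, ℝ)) (u : C(K, 𝕜)) (hu : ∀ k, ‖u k‖ ≤ h k) :
      RCLike.re (ψ u) ≤ Φ (h, 0) := by
    have split : ((0, u) : C(K, ℝ) × C(K, 𝕜)) = (-h, u) + (h, 0) := by simp
    have Φ_neg : Φ (-h, u) ≤ 0 := by
      simpa [p, addNormPosPart_eq_zero (a := (-h, u)) (by simpa using hu)] using hΦp (-h, u)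
    calc RCLike.re (ψ u) = Φ (0, u) := (hΦ ⟨_, u, rfl⟩).symm
      _ = Φ (-h, u) + Φ (h, 0) := by rw [split, map_add]
      _ ≤ Φ (h, 0) := by linarith
  refine ⟨Φ ∘ₗ LinearMap.inl ℝ _ _, fun f => (hΦp (f, 0)).trans ?_, fun h u hu => ?_⟩
  · refine mul_le_mul_of_nonneg_left (norm_addNormPosPart_le (norm_nonneg f) fun k => ?_)
      (norm_nonneg ψ)
    simpa using (le_abs_self _).trans (f.norm_coe_le_norm k)
  · obtain ⟨c, hc, hcu⟩ := RCLike.exists_norm_eq_mul_self (ψ u)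
    have := re_le h (c • u) fun k => by simpa [norm_smul, hc] using hu k
    rwa [map_smul, smul_eq_mul, ← hcu, RCLike.ofReal_re] at this

variable [T2Space K] [MeasurableSpace K] [BorelSpace K]

open scoped CompactlySupported in
lemma exists_measure_norm_apply_le_integral_norm (ψ : StrongDual 𝕜 C(K, 𝕜)) :
    ∃ μ : Measure K, IsFiniteMeasure μ ∧ μ.real Set.univ ≤ ‖ψ‖ ∧
      ∀ u : C(K, 𝕜), ‖ψ u‖ ≤ ∫ k, ‖u k‖ ∂μ := by
  obtain ⟨M, M_le, le_M⟩ := exists_linearMap_norm_apply_le ψ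
  let M' : C_c(K, ℝ) →ₚ[ℝ] ℝ := PositiveLinearMap.mk₀
    { toFun := fun f => M f.toContinuousMap
      map_add' := fun f g => M.map_add f.toContinuousMap g.toContinuousMap
      map_smul' := fun c f => M.map_smul c f.toContinuousMap }
    fun f hf => by simpa using le_M f.toContinuousMap 0 fun k => by simpa using hf k
  have integral_eq (f : C(K, ℝ)) : ∫ k, f k ∂(RealRMK.rieszMeasure M') = M f :=
    RealRMK.integral_rieszMeasure M' (CompactlySupportedContinuousMap.continuousMapEquiv f)
  refine ⟨RealRMK.rieszMeasure M', inferInstance, ?_, fun u => ?_⟩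
  · calc (RealRMK.rieszMeasure M').real Set.univ = M 1 := by simp [← integral_eq]
      _ ≤ ‖ψ‖ * ‖(1 : C(K, ℝ))‖ := M_le 1
      _ ≤ ‖ψ‖ := mul_le_of_le_one_right (norm_nonneg ψ)
          ((ContinuousMap.norm_le _ zero_le_one).2 fun k => by simp)
  · exact (le_M ⟨fun k => ‖u k‖, by fun_prop⟩ u fun k => le_rfl).trans_eq (integral_eq _).symm

end Domination

section Multiplication

variable {𝕜 Ω H : Type*} [RCLike 𝕜] [MeasurableSpace Ω] {μ : Measure Ω}
  [NormedAddCommGroup H] [NormedSpace 𝕜 H]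

/-- The operator `k ↦ (e ↦ ψ (k · Φ e))` from `L_1(μ)` to `H*` attached to a functional `ψ` on
`L_1(μ)` and an operator `Φ : H → L_∞(μ)`. -/
noncomputable def mulDual (ψ : StrongDual 𝕜 (Lp 𝕜 1 μ)) (Φ : H →L[𝕜] Lp 𝕜 ∞ μ) :
    Lp 𝕜 1 μ →L[𝕜] StrongDual 𝕜 H :=
  (.compL 𝕜 _ _ _ ψ ∘L (ContinuousLinearMap.mul 𝕜 𝕜).holderL μ 1 ∞ 1 :
    Lp 𝕜 1 μ →L[𝕜] Lp 𝕜 ∞ μ →L[𝕜] 𝕜).bilinearComp (.id 𝕜 _) Φ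

lemma mulDual_apply (ψ : StrongDual 𝕜 (Lp 𝕜 1 μ)) (Φ : H →L[𝕜] Lp 𝕜 ∞ μ) (k : Lp 𝕜 1 μ) (e : H) :
    mulDual ψ Φ k e = ψ ((ContinuousLinearMap.mul 𝕜 𝕜).holderL μ 1 ∞ 1 k (Φ e)) :=
  rfl

lemma norm_mulDual_le (ψ : StrongDual 𝕜 (Lp 𝕜 1 μ)) (Φ : H →L[𝕜] Lp 𝕜 ∞ μ) :
    ‖mulDual ψ Φ‖ ≤ ‖ψ‖ * ‖Φ‖ := by
  refine ContinuousLinearMap.opNorm_le_bound₂ _ (by positivity) fun k e => ?_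
  have norm_mul_le : ‖(ContinuousLinearMap.mul 𝕜 𝕜).holderL μ 1 ∞ 1‖ ≤ 1 :=
    (ContinuousLinearMap.norm_holderL_le _).trans (by simp)
  rw [mulDual_apply]
  calc _ ≤ ‖ψ‖ * (1 * ‖k‖ * ‖Φ e‖) :=
        ψ.le_opNorm_of_le <| ContinuousLinearMap.le_of_opNorm₂_le_of_le _ norm_mul_le le_rfl le_rfl
    _ ≤ ‖ψ‖ * (1 * ‖k‖ * (‖Φ‖ * ‖e‖)) := by gcongr; exact Φ.le_opNorm e
    _ = ‖ψ‖ * ‖Φ‖ * ‖k‖ * ‖e‖ := by ring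

end Multiplication

section Compact

variable {𝕜 K : Type*} [RCLike 𝕜] [TopologicalSpace K] [CompactSpace K] [MeasurableSpace K]
  [BorelSpace K]

lemma norm_toLp_top_le (μ : Measure K) [IsFiniteMeasure μ] (u : C(K, 𝕜)) :
    ‖ContinuousMap.toLp ∞ μ 𝕜 u‖ ≤ ‖u‖ := by
  simpa using (ContinuousMap.toLp ∞ μ 𝕜 (E := 𝕜)).le_of_opNorm_le
    (ContinuousMap.toLp_norm_le (p := ∞) (μ := μ) (𝕜 := 𝕜) (E := 𝕜)) u

lemma norm_toLp_one_eq_integral_norm (μ : Measure K) [IsFiniteMeasure μ] (u : C(K, 𝕜)) :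
    ‖ContinuousMap.toLp 1 μ 𝕜 u‖ = ∫ k, ‖u k‖ ∂μ := by
  rw [L1.norm_eq_integral_norm]
  exact integral_congr_ae ((ContinuousMap.coeFn_toLp μ u).fun_comp norm)

lemma holderL_linftyToL1_toLp (μ : Measure K) [IsFiniteMeasure μ] (u v : C(K, 𝕜)) :
    (ContinuousLinearMap.mul 𝕜 𝕜).holderL μ 1 ∞ 1 (linftyToL1 μ (ContinuousMap.toLp ∞ μ 𝕜 u))
      (ContinuousMap.toLp ∞ μ 𝕜 v) = ContinuousMap.toLp 1 μ 𝕜 (u * v) := by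
  refine Lp.ext ?_
  filter_upwards [ContinuousMap.coeFn_toLp (p := 1) (𝕜 := 𝕜) μ (u * v),
    ContinuousMap.coeFn_toLp (p := ∞) (𝕜 := 𝕜) μ u, ContinuousMap.coeFn_toLp (p := ∞) (𝕜 := 𝕜) μ v,
    coeFn_linftyToL1 (ContinuousMap.toLp ∞ μ 𝕜 u),
    (ContinuousLinearMap.mul 𝕜 𝕜).coeFn_holder (r := 1)
      (linftyToL1 μ (ContinuousMap.toLp ∞ μ 𝕜 u)) (ContinuousMap.toLp ∞ μ 𝕜 v)]
    with k huv hu hv hincl hmul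
  refine hmul.trans ?_
  rw [huv, hincl, hu, hv]
  rfl

lemma exists_strongDual_toLp_one_eq [T2Space K] (ψ : StrongDual 𝕜 C(K, 𝕜)) :
    ∃ (μ : Measure K) (_ : IsFiniteMeasure μ) (ψ' : StrongDual 𝕜 (Lp 𝕜 1 μ)),
      μ.real Set.univ ≤ ‖ψ‖ ∧ ‖ψ'‖ ≤ 1 ∧ ∀ u, ψ' (ContinuousMap.toLp 1 μ 𝕜 u) = ψ u := by
  obtain ⟨μ, hμ, measure_le, ψ_le⟩ := exists_measure_norm_apply_le_integral_norm ψ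
  obtain ⟨ψ', norm_le, hψ'⟩ := exists_strongDual_comp_eq
    (ContinuousMap.toLp 1 μ 𝕜).toLinearMap ψ.toLinearMap zero_le_one fun u => by
      rw [one_mul]
      exact (ψ_le u).trans_eq (norm_toLp_one_eq_integral_norm μ u).symm
  exact ⟨μ, hμ, ψ', measure_le, norm_le, hψ'⟩

end Compact

section Factorization

set_option maxSynthPendingDepth 4 in
/-- The constants `‖A‖ μ(Ω) Lip(g)` of all factorizations of `R`, whose infimum is
`Lip_{GI}(R)`. -/
def giConstants (𝕜 : Type w) {X : Type u} {E : Type v} [RCLike 𝕜] [MetricSpace X]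
    [NormedAddCommGroup E] [NormedSpace 𝕜 E] (o : X) (R : X → E) : Set ℝ :=
  {c | ∃ (Ω : Type (max u v w)) (_ : MeasurableSpace Ω) (μ : Measure Ω)
      (_ : IsFiniteMeasure μ) (g : X → Lp 𝕜 ∞ μ)
      (A : Lp 𝕜 1 μ →L[𝕜] StrongDual 𝕜 (StrongDual 𝕜 E)),
      IsGIFactorization o R μ g A ∧ c = ‖A‖ * μ.real Set.univ * lipNumber g}

variable {𝕜 : Type w} {X : Type u} {E : Type v} [RCLike 𝕜] [MetricSpace X]
  [NormedAddCommGroup E] [NormedSpace 𝕜 E] {o : X} {R : X → E}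

set_option maxSynthPendingDepth 4 in
lemma exists_mem_giConstants_le_of_strongDual {K : Type (max u v w)} [TopologicalSpace K]
    [CompactSpace K] [T2Space K] (ψ : StrongDual 𝕜 C(K, 𝕜)) {f : X → C(K, 𝕜)} (hf0 : f o = 0)
    (hf : ∀ x y, ‖f x - f y‖ ≤ dist x y) {Φ : StrongDual 𝕜 E →L[𝕜] C(K, 𝕜)} (hΦ : ‖Φ‖ ≤ 1)
    (hψ : ∀ x e, ψ (f x * Φ e) = e (R x)) : ∃ c ∈ giConstants 𝕜 o R, c ≤ ‖ψ‖ := by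
  borelize K
  obtain ⟨μ, hμ, ψ', measure_le, norm_ψ'_le, hψ'⟩ := exists_strongDual_toLp_one_eq ψ
  let g (x : X) : Lp 𝕜 ∞ μ := ContinuousMap.toLp ∞ μ 𝕜 (f x)
  let A := mulDual ψ' (ContinuousMap.toLp ∞ μ 𝕜 ∘L Φ)
  have g_lip (x y : X) : ‖g x - g y‖ ≤ 1 * dist x y := by
    rw [one_mul, ← map_sub]
    exact (norm_toLp_top_le μ _).trans (hf x y)
  have norm_comp_le : ‖ContinuousMap.toLp ∞ μ 𝕜 ∘L Φ‖ ≤ 1 :=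
    ContinuousLinearMap.opNorm_le_bound _ zero_le_one fun e =>
      (norm_toLp_top_le μ (Φ e)).trans (Φ.le_of_opNorm_le hΦ e)
  have norm_A_le : ‖A‖ ≤ 1 :=
    (norm_mulDual_le _ _).trans (mul_le_one₀ norm_ψ'_le (norm_nonneg _) norm_comp_le)
  refine ⟨_, ⟨K, inferInstance, μ, hμ, g, A, ⟨⟨⟨1, ?_⟩, ?_⟩, fun x => ?_⟩, rfl⟩, ?_⟩
  · exact LipschitzWith.of_dist_le_mul fun x y => by simpa [dist_eq_norm] using g_lip x y
  · simp [g, hf0]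
  · ext e
    rw [NormedSpace.dual_def, mulDual_apply]
    exact ((hψ' _).trans (hψ x e)).symm.trans (congrArg ψ' (holderL_linftyToL1_toLp μ _ _)).symm
  · calc ‖A‖ * μ.real Set.univ * lipNumber g ≤ 1 * ‖ψ‖ * 1 := by
          have := lipNumber_nonneg g
          have := lipNumber_le zero_le_one g_lip
          gcongr
      _ = ‖ψ‖ := by ring

end Factorization

section Evaluation

/-- The closed unit ball of `X^#`, with the topology of pointwise convergence. -/
abbrev LipBall (𝕜 : Type*) {X : Type*} [RCLike 𝕜] [MetricSpace X] (o : X) : Type _ :=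
  {f : X → 𝕜 // f o = 0 ∧ LipschitzWith 1 f}

/-- The closed unit ball of the dual space, with the weak-* topology. -/
abbrev WeakDualBall (𝕜 G : Type*) [RCLike 𝕜] [NormedAddCommGroup G] [NormedSpace 𝕜 G] : Type _ :=
  WeakDual.toStrongDual ⁻¹' Metric.closedBall (0 : StrongDual 𝕜 G) 1

variable {𝕜 X G : Type*} [RCLike 𝕜] [MetricSpace X] [NormedAddCommGroup G] [NormedSpace 𝕜 G]
  {o : X}

instance : CompactSpace (LipBall 𝕜 o) := by
  refine (isCompact_iff_compactSpace (s := {f : X → 𝕜 | f o = 0 ∧ LipschitzWith 1 f})).1 ?_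
  refine (isCompact_univ_pi fun x => isCompact_closedBall (0 : 𝕜) (dist x o)).of_isClosed_subset
    ((isClosed_eq (continuous_apply o) continuous_const).inter
      (isClosed_setOfPred_lipschitzWith 1)) ?_
  rintro f ⟨hf0, hf⟩ x -
  simpa [hf0] using hf.dist_le_mul x o

instance : CompactSpace (WeakDualBall 𝕜 G) :=
  isCompact_iff_compactSpace.1 (WeakDual.isCompact_closedBall 0 1)

variable (𝕜 o G) in
/-- Evaluation of Lipschitz functions at `x`, as a function on the product of the two unit balls. -/
def evalLip (x : X) : C(LipBall 𝕜 o × WeakDualBall 𝕜 G, 𝕜) where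
  toFun k := k.1.1 x
  continuous_toFun := (continuous_apply x).comp (continuous_subtype_val.comp continuous_fst)

lemma evalLip_base : evalLip 𝕜 G o o = 0 := by
  ext k
  exact k.1.2.1

lemma norm_evalLip_sub_le (x y : X) : ‖evalLip 𝕜 G o x - evalLip 𝕜 G o y‖ ≤ dist x y :=
  (ContinuousMap.norm_le _ dist_nonneg).2 fun k => by
    simpa [dist_eq_norm] using! k.1.2.2.dist_le_mul x y

lemma norm_apply_le_of_mem_weakDualBall (φ : WeakDualBall 𝕜 G) (e : G) : ‖φ.1 e‖ ≤ ‖e‖ := by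
  simpa using! (WeakDual.toStrongDual φ.1).le_of_opNorm_le (mem_closedBall_zero_iff.1 φ.2) e

variable (𝕜 o G) in
/-- Evaluation of functionals, with values in the functions on the product of the two unit balls. -/
noncomputable def evalDual : G →L[𝕜] C(LipBall 𝕜 o × WeakDualBall 𝕜 G, 𝕜) :=
  LinearMap.mkContinuous
    { toFun := fun e => ⟨fun k => k.2.1 e,
        (WeakDual.eval_continuous e).comp (continuous_subtype_val.comp continuous_snd)⟩
      map_add' := fun e e' => by ext k; exact map_add k.2.1 e e'
      map_smul' := fun c e => by ext k; exact map_smul k.2.1 c e } 1 fun e => by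
    rw [one_mul]
    exact (ContinuousMap.norm_le _ (norm_nonneg e)).2 fun k =>
      norm_apply_le_of_mem_weakDualBall k.2 e

lemma norm_evalDual_le : ‖evalDual 𝕜 G o‖ ≤ 1 :=
  LinearMap.mkContinuous_norm_le _ zero_le_one _

lemma weakSup_le_norm_sum {n : ℕ} (x : Fin n → X) (e : Fin n → G) (a : Fin n → 𝕜) :
    weakSup o x (fun _ => o) e (fun i => a i • ContinuousLinearMap.id 𝕜 𝕜) ≤
      ‖∑ i, a i • (evalLip 𝕜 G o (x i) * evalDual 𝕜 G o (e i))‖ := by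
  refine Real.sSup_le ?_ (norm_nonneg _)
  rintro r ⟨f, φ, hf0, hf, hφ, rfl⟩
  let k : LipBall 𝕜 o × WeakDualBall 𝕜 G :=
    (⟨f, hf0, hf⟩, ⟨StrongDual.toWeakDual φ, by simpa using hφ.le⟩)
  have sum_apply_k : (∑ i, a i • (evalLip 𝕜 G o (x i) * evalDual 𝕜 G o (e i))) k =
      ∑ i, a i * (f (x i) * φ (e i)) := by
    rw [ContinuousMap.sum_apply]
    rfl
  refine ContinuousLinearMap.opNorm_le_bound _ (norm_nonneg _) fun t => ?_
  calc ‖(∑ i, ((f (x i) - f o) * φ (e i)) • a i • ContinuousLinearMap.id 𝕜 𝕜) t‖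
      = ‖∑ i, a i * (f (x i) * φ (e i))‖ * ‖t‖ := by
        rw [← norm_mul, Finset.sum_mul, sum_apply]
        congr 1
        refine Finset.sum_congr rfl fun i _ => ?_
        simp only [hf0, sub_zero, smul_apply, smul_eq_mul, ContinuousLinearMap.id_apply]
        ring
    _ ≤ _ := by
        rw [← sum_apply_k]
        gcongr
        exact ContinuousMap.norm_coe_le_norm _ k

lemma linearCombination_eq_sum_fin {S ι N : Type*} [Semiring S] [AddCommMonoid N] [Module S N]
    (b : ι → N) (v : ι →₀ S) : Finsupp.linearCombination S b v =
      ∑ i, v (v.support.equivFin.symm i) • b (v.support.equivFin.symm i) := by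
  rw [Finsupp.linearCombination_apply, Finsupp.sum, ← Finset.sum_coe_sort v.support]
  exact (Equiv.sum_comp v.support.equivFin.symm fun p => v p • b p).symm

lemma IsIntegralBound.norm_linearCombination_le {T : X × G → 𝕜} {C : ℝ} (hC : 0 ≤ C)
    (hT : ∀ e, T (o, e) = 0) (h : IsIntegralBound 𝕜 o T C) (v : X × G →₀ 𝕜) :
    ‖Finsupp.linearCombination 𝕜 T v‖ ≤
      C * ‖Finsupp.linearCombination 𝕜 (fun p => evalLip 𝕜 G o p.1 * evalDual 𝕜 G o p.2) v‖ := by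
  let s := v.support.equivFin.symm
  rw [linearCombination_eq_sum_fin, linearCombination_eq_sum_fin]
  refine le_trans ?_ (mul_le_mul_of_nonneg_left (weakSup_le_norm_sum _ _ _) hC)
  simpa [hT] using h _ (fun i => (s i).1.1) (fun _ => o) (fun i => (s i).1.2)
    (fun i => v (s i) • ContinuousLinearMap.id 𝕜 𝕜)

lemma IsIntegralBound.exists_strongDual_eval_eq {T : X × G → 𝕜} {C : ℝ} (hC : 0 ≤ C)
    (hT : ∀ e, T (o, e) = 0) (h : IsIntegralBound 𝕜 o T C) :
    ∃ ψ : StrongDual 𝕜 C(LipBall 𝕜 o × WeakDualBall 𝕜 G, 𝕜), ‖ψ‖ ≤ C ∧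
      ∀ x e, ψ (evalLip 𝕜 G o x * evalDual 𝕜 G o e) = T (x, e) := by
  obtain ⟨ψ, norm_le, hψ⟩ := exists_strongDual_comp_eq _ _ hC (h.norm_linearCombination_le hC hT)
  exact ⟨ψ, norm_le, fun x e => by simpa using hψ (Finsupp.single (x, e) 1)⟩

end Evaluation

section Correspondence

variable {𝕜 : Type w} {X : Type u} {E : Type v} [RCLike 𝕜] [MetricSpace X]
  [NormedAddCommGroup E] [NormedSpace 𝕜 E] {o : X} {R : X → E} {c C : ℝ}

set_option maxSynthPendingDepth 4 in
lemma nonneg_of_mem_giConstants (hc : c ∈ giConstants 𝕜 o R) : 0 ≤ c := by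
  obtain ⟨Ω, _, μ, _, g, A, -, rfl⟩ := hc
  have := lipNumber_nonneg g
  positivity

lemma isIntegralBound_of_mem_giConstants (hc : c ∈ giConstants 𝕜 o R) :
    IsIntegralBound 𝕜 o (lipLinearForm 𝕜 R) c := by
  obtain ⟨Ω, _, μ, _, g, A, h, rfl⟩ := hc
  exact h.isIntegralBound

lemma exists_mem_giConstants_le (hR : R o = 0) (hC : 0 ≤ C)
    (h : IsIntegralBound 𝕜 o (lipLinearForm 𝕜 R) C) : ∃ c ∈ giConstants 𝕜 o R, c ≤ C := by
  have form_base (e : StrongDual 𝕜 E) : lipLinearForm 𝕜 R (o, e) = 0 := by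
    simp [lipLinearForm, hR]
  obtain ⟨ψ, norm_ψ_le, hψ⟩ := h.exists_strongDual_eval_eq hC form_base
  obtain ⟨c, hc, c_le⟩ := exists_mem_giConstants_le_of_strongDual (R := R) ψ evalLip_base
    norm_evalLip_sub_le norm_evalDual_le hψ
  exact ⟨c, hc, c_le.trans norm_ψ_le⟩

lemma isLipGI_iff_nonempty_giConstants :
    IsLipGI 𝕜 o R ↔ IsLipZero o R ∧ (giConstants 𝕜 o R).Nonempty := by
  refine and_congr_right fun _ => ⟨?_, ?_⟩
  · rintro ⟨Ω, _, μ, _, g, A, h⟩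
    exact ⟨_, Ω, _, μ, _, g, A, h, rfl⟩
  · rintro ⟨_, Ω, _, μ, _, g, A, h, -⟩
    exact ⟨Ω, _, μ, _, g, A, h⟩

variable (𝕜) in
lemma isLipLinearZero_lipLinearForm_iff :
    IsLipLinearZero 𝕜 o (lipLinearForm 𝕜 R) ↔ IsLipZero o R := by
  constructor
  · rintro ⟨⟨C, hC, hT⟩, -, hT0⟩
    refine ⟨⟨C.toNNReal, LipschitzWith.of_dist_le_mul fun x y => ?_⟩,
      SeparatingDual.eq_zero_of_forall_dual_eq_zero (R := 𝕜) hT0⟩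
    rw [dist_eq_norm, Real.coe_toNNReal C hC.le]
    exact NormedSpace.norm_le_dual_bound 𝕜 _ (by positivity) fun e => by
      simpa [lipLinearForm] using hT x y e
  · rintro ⟨⟨K, hK⟩, hR0⟩
    refine ⟨⟨K + 1, by positivity, fun x y e => ?_⟩, fun x => ⟨fun _ _ => rfl, fun _ _ => rfl⟩,
      fun e => by simp [lipLinearForm, hR0]⟩
    calc ‖e (R x) - e (R y)‖ = ‖e (R x - R y)‖ := by rw [map_sub]
      _ ≤ ‖e‖ * (K * dist x y) :=
        e.le_opNorm_of_le (by simpa [dist_eq_norm] using hK.dist_le_mul x y)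
      _ ≤ (K + 1) * dist x y * ‖e‖ := by
        rw [mul_comm]
        gcongr
        linarith

theorem isLipGI_iff_isIntegral :
    IsLipGI 𝕜 o R ↔ IsIntegral 𝕜 o (lipLinearForm 𝕜 R) := by
  rw [isLipGI_iff_nonempty_giConstants, IsIntegral, isLipLinearZero_lipLinearForm_iff]
  refine and_congr_right fun hR => ⟨?_, ?_⟩
  · rintro ⟨c, hc⟩
    have := nonneg_of_mem_giConstants hc
    exact ⟨c + 1, by positivity, (isIntegralBound_of_mem_giConstants hc).mono (by linarith)⟩
  · rintro ⟨C, hC, h⟩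
    obtain ⟨c, hc, -⟩ := exists_mem_giConstants_le hR.2 hC.le h
    exact ⟨c, hc⟩

theorem lipGINorm_eq_integralNorm (h : IsLipGI 𝕜 o R) :
    lipGINorm 𝕜 o R = integralNorm 𝕜 o (lipLinearForm 𝕜 R) := by
  change sInf (giConstants 𝕜 o R) = _
  obtain ⟨hR, hne⟩ := isLipGI_iff_nonempty_giConstants.1 h
  refine le_antisymm (le_csInf (isLipGI_iff_isIntegral.1 h).2 ?_) (le_csInf hne fun c hc => ?_)
  · rintro C ⟨hC, hCT⟩
    obtain ⟨c, hc, c_le⟩ := exists_mem_giConstants_le hR.2 hC.le hCT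
    exact (csInf_le ⟨0, fun _ => nonneg_of_mem_giConstants⟩ hc).trans c_le
  · refine le_of_forall_pos_le_add fun ε hε => csInf_le ⟨0, fun C hC => hC.1.le⟩ ⟨?_, ?_⟩
    · linarith [nonneg_of_mem_giConstants hc]
    · exact (isIntegralBound_of_mem_giConstants hc).mono (by linarith)

end Correspondence

end LipLin

theorem mainTheorem5_general {𝕜 : Type w} {X : Type u} {E : Type v} [RCLike 𝕜] [MetricSpace X]
    (o : X) [NormedAddCommGroup E] [NormedSpace 𝕜 E] (R : X → E) :
    (LipLin.IsLipGI 𝕜 o R ↔ LipLin.IsIntegral 𝕜 o (LipLin.lipLinearForm 𝕜 R)) ∧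
      (LipLin.IsLipGI 𝕜 o R →
        LipLin.lipGINorm 𝕜 o R = LipLin.integralNorm 𝕜 o (LipLin.lipLinearForm 𝕜 R)) :=
  ⟨LipLin.isLipGI_iff_isIntegral, LipLin.lipGINorm_eq_integralNorm⟩

theorem mainTheorem5 {𝕜 : Type w} {X : Type u} {E : Type v} [RCLike 𝕜] [MetricSpace X] (o : X)
    [NormedAddCommGroup E] [NormedSpace 𝕜 E] [CompleteSpace E]
    (R : X → E) (hR : ∃ K, LipschitzWith K R) :
    (LipLin.IsLipGI 𝕜 o R ↔ LipLin.IsIntegral 𝕜 o (LipLin.lipLinearForm 𝕜 R)) ∧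
      (LipLin.IsLipGI 𝕜 o R →
        LipLin.lipGINorm 𝕜 o R = LipLin.integralNorm 𝕜 o (LipLin.lipLinearForm 𝕜 R)) :=
  mainTheorem5_general o R
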